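/- **Theorem 2.13.** Let $\mathcal F$ be a unital C*-algebra and let $\mathfrak S_0$ be a non-empty folium of states of $\mathcal F$, i.e. a norm-closed convex set of states such that $\omega\in\mathfrak S_0$, $B\in\mathcal F$, $\omega(B^*B)=1$ imply $\omega(B^*\,\cdot\,B)\in\mathfrak S_0$. An *ideal host* for $(\mathcal F,\mathfrak S_0)$ is a (not necessarily unital) C*-algebra $\mathcal L$ for which there are a unital C*-algebra $\mathcal E$ containing $\mathcal L$ as a closed two-sided ideal and a unital $*$-homomorphism $\xi:\mathcal F\to\mathcal E$ such that $\mathcal E$ is generated as a C*-algebra by $\mathcal L\cup\xi(\mathcal F)$, and such that the map $\theta$ from the states of $\mathcal L$ to the states of $\mathcal F$, which sends $\omega$ to $\widehat\omega\circ\xi$, where $\widehat\omega$ is the unique extension of $\omega$ to a state of $\mathcal E$, is injective with range exactly $\mathfrak S_0$. For each $\omega\in\mathfrak S_0$ let $(\pi_\omega,\mathcal H_\omega,\Omega_\omega)$ be its GNS representation, choose a maximal commutative $*$-subalgebra $\mathcal C_\omega$ of the commutant $\pi_\omega(\mathcal F)'$, let $X_\omega$ be the spectrum of $\mathcal C_\omega$,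 and let $\mu_\omega$ be the regular Borel probability measure on $X_\omega$ with $\langle\Omega_\omega, C\,\Omega_\omega\rangle=\int_{X_\omega}\widehat C\,d\mu_\omega$ for all $C\in\mathcal C_\omega$, where $\widehat C$ is the Gelfand transform of $C$. Let $(X,\mu)$ be the disjoint union of the measure spaces $(X_\omega,\mu_\omega)$, $\omega\in\mathfrak S_0$. Then, for every choice of the algebras $\mathcal C_\omega$: if $(\mathcal F,\mathfrak S_0)$ has an ideal host, then $\mu$ has a discrete point, i.e. there is $x\in X$ with $\mu(\{x\})>0$. Consequently, if $\mu$ is purely continuous, i.e. $\mu(\{x\})=0$ for all $x\in X$, then $(\mathcal F,\mathfrak S_0)$ has no ideal host. -/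

import Mathlib

open scoped ComplexOrder InnerProductSpace

universe u v w

namespace HostAlgebra

/-- The state space of a (not necessarily unital) C⋆-algebra: the positive linear functionals of
norm one. It is viewed inside the normed dual, so its topology is the norm topology. -/
abbrev State (A : Type*) [NonUnitalCStarAlgebra A] : Type _ :=
  {φ : StrongDual ℂ A // (∀ a : A, 0 ≤ φ (star a * a)) ∧ ‖φ‖ = 1}

/-! ### Host algebras -/

/-- For C⋆-algebras `L → E ← F`, the relation `θ(ω) = η` between states `ω` of `L` and `η` of `F`:
the functional `η` is obtained by extending `ω` to a state of `E` and restricting this extension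
to `F`. When the image of `L` is a hereditary subalgebra of `E`, every state of `L` has exactly one
extension to a state of `E`, and the relation is the graph of the map `θ`. -/
def ExtensionMap {F : Type u} {L : Type v} {E : Type w} [CStarAlgebra F]
    [NonUnitalCStarAlgebra L] [CStarAlgebra E] (ι : L →⋆ₙₐ[ℂ] E) (ξ : F →⋆ₐ[ℂ] E)
    (ω : State L) (η : State F) : Prop :=
  ∃ σ : State E, (∀ l : L, σ.1 (ι l) = ω.1 l) ∧ ∀ f : F, η.1 f = σ.1 (ξ f)

set_option linter.checkUnivs false in
/-- A host for a pair `(F, S₀)`, where `F` is a unital C⋆-algebra and `S₀` a set of states. -/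
structure Host (F : Type u) [CStarAlgebra F] (S₀ : Set (State F)) where
  /-- the host algebra -/
  L : Type v
  /-- the unital C⋆-algebra containing the host algebra and receiving `F` -/
  E : Type w
  [cstarL : NonUnitalCStarAlgebra L]
  [cstarE : CStarAlgebra E]
  /-- the embedding of `L` into `E` -/
  ι : L →⋆ₙₐ[ℂ] E
  /-- the unital ⋆-homomorphism from `F` to `E` -/
  ξ : F →⋆ₐ[ℂ] E
  ι_injective : Function.Injective ι
  hereditary : ∀ (a b : L) (e : E), ι a * e * ι b ∈ Set.range ι
  generated : (StarAlgebra.adjoin ℂ (Set.range ι ∪ Set.range ξ)).topologicalClosure = ⊤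
  θ_injective : ∀ (ω₁ ω₂ : State L) (η : State F),
    ExtensionMap ι ξ ω₁ η → ExtensionMap ι ξ ω₂ η → ω₁ = ω₂
  θ_range : ∀ η : State F, η ∈ S₀ ↔ ∃ ω : State L, ExtensionMap ι ξ ω η

attribute [instance] Host.cstarL Host.cstarE

/-- A host is an ideal host if it is a two-sided ideal of the ambient algebra. -/
def Host.IsIdealHost {F : Type u} [CStarAlgebra F] {S₀ : Set (State F)}
    (h : Host.{u, v, w} F S₀) : Prop :=
  ∀ (l : h.L) (e : h.E), e * h.ι l ∈ Set.range h.ι ∧ h.ι l * e ∈ Set.range h.ι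

/-- The pair `(F, S₀)` has an ideal host. -/
def HasIdealHost (F : Type u) [CStarAlgebra F] (S₀ : Set (State F)) : Prop :=
  ∃ h : Host.{u, v, w} F S₀, h.IsIdealHost

/-- A folium of states: a norm-closed convex set of states which is invariant under
`ω ↦ ω(b⋆ · b)` whenever `ω(b⋆ b) = 1`. -/
structure IsFolium {F : Type u} [CStarAlgebra F] (S₀ : Set (State F)) : Prop where
  isClosed : IsClosed (Subtype.val '' S₀ : Set (StrongDual ℂ F))
  convex : Convex ℝ (Subtype.val '' S₀ : Set (StrongDual ℂ F))
  invariant : ∀ ω ∈ S₀, ∀ b : F, ω.1 (star b * b) = 1 →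
    ∀ η : State F, (∀ f : F, η.1 f = ω.1 (star b * f * b)) → η ∈ S₀

/-! ### The GNS representation of a state -/

section GNS

variable {F : Type u} [CStarAlgebra F] [PartialOrder F] [StarOrderedRing F]

/-- A state as a positive linear functional in Mathlib's sense. -/
noncomputable def State.toPLM (ω : State F) : F →ₚ[ℂ] ℂ :=
  PositiveLinearMap.mk₀ (ω.1 : F →ₗ[ℂ] ℂ) (by
    intro x hx
    obtain ⟨y, rfl⟩ := CStarAlgebra.nonneg_iff_eq_star_mul_self.mp hx
    exact ω.2.1 y)

/-- The Hilbert space of the GNS representation of `ω`. -/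
abbrev State.H (ω : State F) : Type u := ω.toPLM.GNS

/-- The GNS representation of `ω`. -/
noncomputable def State.π (ω : State F) : F →⋆ₐ[ℂ] (ω.H →L[ℂ] ω.H) := ω.toPLM.gnsStarAlgHom

/-- The cyclic vector of the GNS representation of `ω`. -/
noncomputable def State.Ω (ω : State F) : ω.H := ((ω.toPLM.toPreGNS 1 : ω.toPLM.PreGNS) : ω.H)

end GNS

/-! ### Maximal commutative subalgebras of the commutant and their spectral measures -/

/-- A maximal commutative ⋆-subalgebra of the commutant `π(F)'` of a representation. It is
automatically a von Neumann algebra. -/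
structure MaxAbelian {F : Type u} [CStarAlgebra F] {H : Type v} [NormedAddCommGroup H]
    [InnerProductSpace ℂ H] [CompleteSpace H] (π : F →⋆ₐ[ℂ] (H →L[ℂ] H)) where
  /-- the subalgebra -/
  alg : StarSubalgebra ℂ (H →L[ℂ] H)
  commutant : ∀ T ∈ alg, ∀ f : F, T * π f = π f * T
  comm : ∀ S ∈ alg, ∀ T ∈ alg, S * T = T * S
  maximal : ∀ T : H →L[ℂ] H, (∀ f : F, T * π f = π f * T) → (∀ S ∈ alg, S * T = T * S) → T ∈ alg

namespace MaxAbelian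

variable {F : Type u} [CStarAlgebra F] {H : Type v} [NormedAddCommGroup H]
  [InnerProductSpace ℂ H] [CompleteSpace H] {π : F →⋆ₐ[ℂ] (H →L[ℂ] H)}

theorem isClosed (C : MaxAbelian π) : IsClosed (C.alg : Set (H →L[ℂ] H)) := by
  have h : (C.alg : Set (H →L[ℂ] H)) =
      Set.centralizer (Set.range π) ∩ Set.centralizer (C.alg : Set (H →L[ℂ] H)) := by
    ext T
    constructor
    · intro hT
      refine ⟨?_, fun S hS => C.comm S hS T hT⟩
      rintro _ ⟨f, rfl⟩
      exact (C.commutant T hT f).symm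
    · rintro ⟨h1, h2⟩
      exact C.maximal T (fun f => (h1 (π f) ⟨f, rfl⟩).symm) fun S hS => h2 S hS
  rw [h]
  exact (Set.isClosed_centralizer _).inter (Set.isClosed_centralizer _)

noncomputable instance (C : MaxAbelian π) : CommCStarAlgebra C.alg :=
  { StarSubalgebra.cstarAlgebra C.alg (h_closed := C.isClosed) with
    mul_comm := fun S T => Subtype.ext (C.comm S.1 S.2 T.1 T.2) }

/-- The spectrum (Gelfand space) of the commutative C⋆-algebra `C`. -/
abbrev X (C : MaxAbelian π) : Type v := WeakDual.characterSpace ℂ C.alg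

noncomputable instance (C : MaxAbelian π) : MeasurableSpace C.X := borel _

instance (C : MaxAbelian π) : BorelSpace C.X := ⟨rfl⟩

/-- The element of `C` whose Gelfand transform is the real continuous function `f`. -/
noncomputable def ofFun (C : MaxAbelian π) (f : C(C.X, ℝ)) : H →L[ℂ] H :=
  ((gelfandStarTransform C.alg).symm
    (⟨fun x => (f x : ℂ), Complex.continuous_ofReal.comp f.continuous⟩ : C(C.X, ℂ))).1

theorem ofFun_add (C : MaxAbelian π) (f g : C(C.X, ℝ)) :
    C.ofFun (f + g) = C.ofFun f + C.ofFun g := by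
  unfold ofFun
  rw [← AddMemClass.coe_add, ← map_add]
  congr 2
  ext x
  simp

theorem ofFun_mul (C : MaxAbelian π) (f g : C(C.X, ℝ)) :
    C.ofFun (f * g) = C.ofFun f * C.ofFun g := by
  unfold ofFun
  rw [← MulMemClass.coe_mul, ← map_mul]
  congr 2
  ext x
  simp

theorem ofFun_smul (C : MaxAbelian π) (r : ℝ) (f : C(C.X, ℝ)) :
    C.ofFun (r • f) = (r : ℂ) • C.ofFun f := by
  unfold ofFun
  rw [← SetLike.val_smul, ← map_smul]
  congr 2
  ext x
  simp

theorem star_ofFun (C : MaxAbelian π) (f : C(C.X, ℝ)) : star (C.ofFun f) = C.ofFun f := by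
  unfold ofFun
  rw [← StarMemClass.coe_star, ← map_star]
  congr 2
  ext x
  simp

theorem ofFun_nonneg (C : MaxAbelian π) (Ω : H) (f : C(C.X, ℝ)) (hf : 0 ≤ f) :
    0 ≤ (⟪Ω, C.ofFun f Ω⟫_ℂ).re := by
  obtain ⟨g, rfl⟩ : ∃ g : C(C.X, ℝ), f = g * g :=
    ⟨⟨fun x => Real.sqrt (f x), Real.continuous_sqrt.comp f.continuous⟩, by
      ext x
      exact (Real.mul_self_sqrt (hf x)).symm⟩
  rw [C.ofFun_mul]
  nth_rewrite 1 [← C.star_ofFun g]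
  rw [ContinuousLinearMap.star_eq_adjoint, mul_apply_eq_comp,
    ContinuousLinearMap.adjoint_inner_right]
  exact inner_self_nonneg (𝕜 := ℂ)

/-- The vector functional `c ↦ ⟨Ω, c Ω⟩` on `C ≅ C(X)`. -/
noncomputable def functional (C : MaxAbelian π) (Ω : H) :
    CompactlySupportedContinuousMap C.X ℝ →ₚ[ℝ] ℝ :=
  PositiveLinearMap.mk₀
    { toFun := fun f => (⟪Ω, C.ofFun f.toContinuousMap Ω⟫_ℂ).re
      map_add' := fun f g => by
        have h : (f + g).toContinuousMap = f.toContinuousMap + g.toContinuousMap := rfl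
        rw [h, C.ofFun_add, add_apply, inner_add_right, Complex.add_re]
      map_smul' := fun r f => by
        have h : (r • f).toContinuousMap = r • f.toContinuousMap := rfl
        rw [h, C.ofFun_smul, smul_apply, inner_smul_right,
          Complex.re_ofReal_mul]
        rfl }
    (fun f hf => C.ofFun_nonneg Ω f.toContinuousMap fun x => hf x)

/-- The regular Borel measure `μ` on the spectrum `X` of `C` which represents the vector functional
of `Ω`, that is, `⟨Ω, c Ω⟩ = ∫ ĉ dμ`, where `ĉ` is the Gelfand transform of `c`. -/
noncomputable def measure (C : MaxAbelian π) (Ω : H) : MeasureTheory.Measure C.X :=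
  RealRMK.rieszMeasure (C.functional Ω)

end MaxAbelian

/-! ### The measure space `(X, μ)` of a pair `(F, S₀)` -/

section Data

variable {F : Type u} [CStarAlgebra F] [PartialOrder F] [StarOrderedRing F]

/-- A choice, for each `ω ∈ S₀`, of a maximal commutative subalgebra of `π_ω(F)'`. -/
abbrev Choice (S₀ : Set (State F)) : Type u := ∀ ω : S₀, MaxAbelian (State.π (ω : State F))

/-- The disjoint union of the spectra `X_ω`, `ω ∈ S₀`. -/
abbrev TotalSpace {S₀ : Set (State F)} (C : Choice S₀) : Type u := Σ ω : S₀, (C ω).X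

/-- The measure on the disjoint union which restricts to `μ_ω` on each `X_ω`, where `μ_ω` is the
measure given by the GNS cyclic vector of `ω`. -/
noncomputable def totalMeasure {S₀ : Set (State F)} (C : Choice S₀) :
    MeasureTheory.Measure (TotalSpace C) :=
  MeasureTheory.Measure.sum fun ω : S₀ =>
    ((C ω).measure (State.Ω (ω : State F))).map (Sigma.mk ω)

end Data

end HostAlgebra

/-! An ideal host `L` makes the folium behave like the state space of a C*-algebra, and such a space
has extreme points. Starting from any state of `L`, Krein–Milman gives a pure state
(`exists_pure_state`). Since `L` is an ideal in `E`, this state extends to `E` (`exists_extension`)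
and restricts to some `η` in the folium. By injectivity of `θ`, a convex decomposition of `η` inside
the folium lifts to one of the pure state. It is therefore trivial upstairs, and trivial downstairs
by `extension_unique`. So `η` is extreme in the folium (`HasIdealHost.exists_extreme`).

A folium contains every vector state of the GNS representation of `η` (`IsFolium.vectorState_mem`).
If `X_η` had two points, a continuous function `f` separating them would split `η` into the vector
functionals of `√f Ω` and `√(1 - f) Ω`; extremality then makes `f` constant, a contradiction. Hence
`X_η` is a single point, and it carries the whole nonzero mass of `μ_η`. -/

open Filter Topology

namespace HostAlgebra

/-! ### Positive functionals along an approximate unit -/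

section NonUnital

variable {A : Type*} [NonUnitalCStarAlgebra A]

/-- The Cauchy–Schwarz inequality for positive functionals. -/
theorem norm_apply_star_mul_sq_le {φ : StrongDual ℂ A} (hφ : ∀ a : A, 0 ≤ φ (star a * a))
    (a b : A) :
    ‖φ (star a * b)‖ ^ 2 ≤ (φ (star a * a)).re * (φ (star b * b)).re := by
  let : PartialOrder A := CStarAlgebra.spectralOrder A
  have : StarOrderedRing A := CStarAlgebra.spectralOrderedRing A
  let f : A →ₚ[ℂ] ℂ := PositiveLinearMap.mk₀ (φ : A →ₗ[ℂ] ℂ) (by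
    intro x hx
    obtain ⟨y, rfl⟩ := CStarAlgebra.nonneg_iff_eq_star_mul_self.mp hx
    exact hφ y)
  have h := inner_mul_inner_self_le (𝕜 := ℂ) (f.toPreGNS a) (f.toPreGNS b)
  rw [norm_inner_symm (f.toPreGNS b)] at h
  rw [sq]
  exact h

theorem norm_apply_star_mul_self_le (φ : StrongDual ℂ A) (a : A) :
    ‖φ (star a * a)‖ ≤ ‖φ‖ * ‖a‖ ^ 2 := by
  simpa [CStarRing.norm_star_mul_self, sq] using φ.le_opNorm (star a * a)

variable [PartialOrder A] [StarOrderedRing A]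

theorem eventually_norm_star_mul_self_le :
    ∀ᶠ u in CStarAlgebra.approximateUnit A, ‖star u * u‖ ≤ 1 := by
  filter_upwards [(CStarAlgebra.increasingApproximateUnit A).eventually_norm] with u hu
  rw [CStarRing.norm_star_mul_self]
  exact mul_le_one₀ hu (norm_nonneg _) hu

/-- For `‖a‖ < 1`, Cauchy–Schwarz gives `|φ(u a)|² ≤ φ(u²)` eventually, while `φ(u a) → φ(a)` and
`|φ(a)|` can be taken as close to `‖φ‖ = 1` as desired. -/
theorem tendsto_apply_star_mul_self {φ : StrongDual ℂ A} (hφ : ∀ a : A, 0 ≤ φ (star a * a))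
    (h1 : ‖φ‖ = 1) :
    Tendsto (fun u => φ (star u * u)) (CStarAlgebra.approximateUnit A) (𝓝 1) := by
  have hre : ∀ u : A, φ (star u * u) = ((φ (star u * u)).re : ℂ) := fun u =>
    (Complex.eq_re_of_ofReal_le (r := 0) (by simpa using hφ u))
  suffices Tendsto (fun u => (φ (star u * u)).re) (CStarAlgebra.approximateUnit A) (𝓝 1) by
    have h2 := (Complex.continuous_ofReal.tendsto 1).comp this
    rw [Complex.ofReal_one] at h2
    exact h2.congr fun u => (hre u).symm
  refine tendsto_order.2 ⟨fun c hc => ?_, fun c hc => ?_⟩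
  · rcases lt_or_ge c 0 with h0 | h0
    · exact Eventually.of_forall fun u => h0.trans_le (Complex.nonneg_iff.mp (hφ u)).1
    have hs : √c < ‖φ‖ := by
      rw [h1, Real.sqrt_lt' one_pos]
      simpa using hc
    obtain ⟨a, ha, hca⟩ := φ.exists_lt_apply_of_lt_opNorm hs
    have hl := (CStarAlgebra.increasingApproximateUnit A)
    have ht : Tendsto (fun u => ‖φ (u * a)‖) (CStarAlgebra.approximateUnit A) (𝓝 ‖φ a‖) :=
      ((φ.continuous.tendsto a).comp (hl.tendsto_mul_right a)).norm
    filter_upwards [(tendsto_order.1 ht).1 _ hca, hl.eventually_star_eq] with u hu hus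
    have hcs := norm_apply_star_mul_sq_le hφ u a
    rw [hus] at hcs ⊢
    have h3 : (φ (star a * a)).re ≤ 1 := by
      refine (Complex.re_le_norm _).trans ((norm_apply_star_mul_self_le φ a).trans ?_)
      rw [h1, one_mul]
      exact pow_le_one₀ (norm_nonneg _) ha.le
    have h4 : c < ‖φ (u * a)‖ ^ 2 := by
      rwa [← Real.sqrt_lt_sqrt_iff h0, Real.sqrt_sq (norm_nonneg _)]
    have h5 : 0 ≤ (φ (u * u)).re := by
      have := (Complex.nonneg_iff.mp (hφ u)).1
      rwa [hus] at this
    nlinarith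
  · filter_upwards [eventually_norm_star_mul_self_le (A := A)] with u hu
    refine lt_of_le_of_lt ((Complex.re_le_norm _).trans ?_) hc
    simpa [h1] using φ.le_opNorm_of_le hu

end NonUnital

section NonUnital

variable {A : Type*} [NonUnitalCStarAlgebra A]

/-- Both functionals attain their norm along the same approximate unit, so the triangle inequality
is an equality. -/
theorem norm_convexCombination_eq_one {φ ψ : StrongDual ℂ A} (hφ : ∀ a : A, 0 ≤ φ (star a * a))
    (hψ : ∀ a : A, 0 ≤ ψ (star a * a)) (h1 : ‖φ‖ = 1) (h2 : ‖ψ‖ = 1) {s t : ℝ} (hs : 0 ≤ s)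
    (ht : 0 ≤ t) (hst : s + t = 1) : ‖s • φ + t • ψ‖ = 1 := by
  let : PartialOrder A := CStarAlgebra.spectralOrder A
  have : StarOrderedRing A := CStarAlgebra.spectralOrderedRing A
  apply le_antisymm
  · calc _ ≤ ‖s • φ‖ + ‖t • ψ‖ := norm_add_le _ _
      _ = 1 := by simp [norm_smul, h1, h2, abs_of_nonneg hs, abs_of_nonneg ht, hst]
  · have h : Tendsto (fun u => ‖(s • φ + t • ψ) (star u * u)‖) (CStarAlgebra.approximateUnit A)
        (𝓝 ‖s • (1 : ℂ) + t • (1 : ℂ)‖) :=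
      (((tendsto_apply_star_mul_self hφ h1).const_smul s).add
        ((tendsto_apply_star_mul_self hψ h2).const_smul t)).norm
    rw [← add_smul, hst, one_smul, norm_one] at h
    refine le_of_tendsto h ?_
    filter_upwards [eventually_norm_star_mul_self_le (A := A)] with u hu
    simpa using (s • φ + t • ψ).le_opNorm_of_le hu

/-- The convex combination of two states. -/
noncomputable def State.mix (φ ψ : State A) (s t : ℝ) (hs : 0 ≤ s) (ht : 0 ≤ t)
    (hst : s + t = 1) : State A :=
  ⟨s • φ.1 + t • ψ.1, fun a => by
    simpa using add_nonneg (smul_nonneg hs (φ.2.1 a)) (smul_nonneg ht (ψ.2.1 a)),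
    norm_convexCombination_eq_one φ.2.1 ψ.2.1 φ.2.2 ψ.2.2 hs ht hst⟩

end NonUnital

section Unital

variable {A : Type*} [CStarAlgebra A]

theorem norm_sq_apply_le {φ : StrongDual ℂ A} (hφ : ∀ a : A, 0 ≤ φ (star a * a)) (a : A) :
    ‖φ a‖ ^ 2 ≤ (φ 1).re * (φ (star a * a)).re := by
  simpa using norm_apply_star_mul_sq_le hφ 1 a

/-- Cauchy–Schwarz against `1` gives `‖φ‖² ≤ φ(1) ‖φ‖`. The zero algebra is excluded on each side so
that `‖1‖ = 1`. -/
theorem norm_eq_one_iff_apply_one {φ : StrongDual ℂ A} (hφ : ∀ a : A, 0 ≤ φ (star a * a)) :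
    ‖φ‖ = 1 ↔ φ 1 = 1 := by
  have h0 : 0 ≤ φ 1 := by simpa using hφ 1
  have hre : φ 1 = ((φ 1).re : ℂ) := Complex.eq_re_of_ofReal_le (r := 0) (by simpa using h0)
  have h0' : 0 ≤ (φ 1).re := (Complex.nonneg_iff.mp h0).1
  have key : ‖φ‖ ≤ √((φ 1).re * ‖φ‖) := by
    refine φ.opNorm_le_bound (Real.sqrt_nonneg _) fun a => ?_
    refine abs_le_of_sq_le_sq' ?_ (by positivity) |>.2
    rw [mul_pow, Real.sq_sqrt (by positivity), mul_assoc]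
    refine (norm_sq_apply_le hφ a).trans ?_
    gcongr
    exact (Complex.re_le_norm _).trans (norm_apply_star_mul_self_le φ a)
  have key2 : ‖φ‖ ^ 2 ≤ (φ 1).re * ‖φ‖ := by
    rw [← Real.sq_sqrt (show 0 ≤ (φ 1).re * ‖φ‖ by positivity)]
    gcongr
  constructor
  · intro h
    have : Nontrivial A := by
      by_contra hn
      rw [not_nontrivial_iff_subsingleton] at hn
      have : φ = 0 := by
        ext a
        rw [Subsingleton.elim a 0]
        simp
      simp [this] at h
    have h1 : (φ 1).re ≤ 1 := by
      refine (Complex.re_le_norm _).trans ?_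
      simpa [h] using φ.le_opNorm 1
    rw [h] at key2
    rw [hre, le_antisymm h1 (by linarith), Complex.ofReal_one]
  · intro h
    have : Nontrivial A := by
      by_contra hn
      rw [not_nontrivial_iff_subsingleton] at hn
      rw [Subsingleton.elim (1 : A) 0, map_zero] at h
      exact zero_ne_one h
    have h1 : 1 ≤ ‖φ‖ := by simpa [h] using φ.le_opNorm 1
    rw [h, Complex.one_re] at key2
    exact le_antisymm (by nlinarith) h1

theorem State.apply_one (φ : State A) : φ.1 1 = 1 := (norm_eq_one_iff_apply_one φ.2.1).1 φ.2.2

/-- The pull-back of a state along a unital ⋆-homomorphism. -/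
noncomputable def State.comap {B : Type*} [CStarAlgebra B] (φ : State A) (ξ : B →⋆ₐ[ℂ] A) :
    State B :=
  let ψ : StrongDual ℂ B := φ.1.comp (ξ.toAlgHom.toLinearMap.mkContinuous 1 fun b => by
    simpa using NonUnitalStarAlgHom.norm_apply_le ξ b)
  have hψ : ∀ b, 0 ≤ ψ (star b * b) := fun b => by
    simpa [ψ, map_star] using φ.2.1 (ξ b)
  ⟨ψ, hψ, (norm_eq_one_iff_apply_one hψ).2 (by simpa [ψ] using φ.apply_one)⟩

theorem State.comap_apply {B : Type*} [CStarAlgebra B] (φ : State A) (ξ : B →⋆ₐ[ℂ] A) (b : B) :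
    (φ.comap ξ).1 b = φ.1 (ξ b) := rfl

end Unital

end HostAlgebra

namespace HostAlgebra

/-! ### Extending states from a two-sided ideal -/

section Ideal

variable {L : Type*} {E : Type*} [NonUnitalCStarAlgebra L] [CStarAlgebra E] {ι : L →⋆ₙₐ[ℂ] E}

/-- Cauchy–Schwarz bounds `|σ((1 - u) e)|²` by `σ((1 - u)²) σ(e* e)`. Since `u² ≤ u`, one has `(1 -
u)² ≤ 1 - u²`, and `σ(1 - u²) = 1 - ω(u²) → 0`. In an ideal `u e` lies in `L`, so `σ` is determined
by `ω`. -/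
theorem tendsto_apply_mul_of_restrict [PartialOrder L] [StarOrderedRing L] {ω : State L}
    {σ : State E} (hσ : ∀ l : L, σ.1 (ι l) = ω.1 l) (e : E) :
    Tendsto (fun u => σ.1 (ι u * e)) (CStarAlgebra.approximateUnit L) (𝓝 (σ.1 e)) := by
  let : PartialOrder E := CStarAlgebra.spectralOrder E
  have : StarOrderedRing E := CStarAlgebra.spectralOrderedRing E
  have hl := CStarAlgebra.increasingApproximateUnit L
  have hmono : ∀ x y : E, x ≤ y → (σ.1 x).re ≤ (σ.1 y).re := fun x y hxy => by
    obtain ⟨z, hz⟩ := CStarAlgebra.nonneg_iff_eq_star_mul_self.mp (sub_nonneg.2 hxy)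
    have h := (Complex.nonneg_iff.mp (σ.2.1 z)).1
    rw [← hz, map_sub, Complex.sub_re] at h
    linarith
  have hlim : Tendsto (fun u => (1 - (ω.1 (star u * u)).re) * (σ.1 (star e * e)).re)
      (CStarAlgebra.approximateUnit L) (𝓝 0) := by
    have h := (Complex.continuous_re.tendsto 1).comp (tendsto_apply_star_mul_self ω.2.1 ω.2.2)
    simpa using ((tendsto_const_nhds (x := (1 : ℝ))).sub h).mul_const (σ.1 (star e * e)).re
  have hsq : Tendsto (fun u => ‖σ.1 (ι u * e) - σ.1 e‖ ^ 2) (CStarAlgebra.approximateUnit L)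
      (𝓝 0) := by
    refine squeeze_zero' (Eventually.of_forall fun u => by positivity) ?_ hlim
    filter_upwards [hl.eventually_nonneg, hl.eventually_norm, hl.eventually_star_eq] with u h0 h1 hs
    have hv0 : 0 ≤ ι u := by
      obtain ⟨z, rfl⟩ := CStarAlgebra.nonneg_iff_eq_star_mul_self.mp h0
      rw [map_mul, map_star]
      exact star_mul_self_nonneg _
    have hv : ι u ∈ Set.Icc 0 1 := CStarAlgebra.mem_Icc_iff_norm_le_one.mpr
      ⟨hv0, (NonUnitalStarAlgHom.norm_apply_le ι u).trans h1⟩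
    have hvs : star (ι u) = ι u := by rw [← map_star, hs]
    have hcs := norm_apply_star_mul_sq_le σ.2.1 (1 - ι u) e
    have hle : star (1 - ι u) * (1 - ι u) ≤ 1 - ι u * ι u := by
      have h2 : ι u * ι u ≤ ι u := by simpa [sq] using CStarAlgebra.pow_antitone hv.1 hv.2 one_le_two
      rw [star_sub, star_one, hvs, ← sub_nonneg]
      have h3 : 1 - ι u * ι u - (1 - ι u) * (1 - ι u) = (ι u - ι u * ι u) + (ι u - ι u * ι u) := by
        noncomm_ring
      rw [h3]
      exact add_nonneg (sub_nonneg.2 h2) (sub_nonneg.2 h2)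
    have h4 := hmono _ _ hle
    rw [map_sub, σ.apply_one, ← map_mul, hσ, Complex.sub_re, Complex.one_re] at h4
    rw [star_sub, star_one, hvs, sub_mul, one_mul, map_sub, norm_sub_rev] at hcs
    refine hcs.trans ?_
    rw [hs]
    rw [star_sub, star_one, hvs] at h4
    exact mul_le_mul_of_nonneg_right h4 (Complex.nonneg_iff.mp (σ.2.1 e)).1
  rw [tendsto_iff_norm_sub_tendsto_zero]
  simpa using hsq.sqrt

/-- A state of a two-sided ideal has at most one extension to a state of the algebra. -/
theorem extension_unique (hι : ∀ (l : L) (e : E), ι l * e ∈ Set.range ι) {ω : State L}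
    {σ τ : State E} (hσ : ∀ l : L, σ.1 (ι l) = ω.1 l) (hτ : ∀ l : L, τ.1 (ι l) = ω.1 l) :
    σ = τ := by
  let : PartialOrder L := CStarAlgebra.spectralOrder L
  have : StarOrderedRing L := CStarAlgebra.spectralOrderedRing L
  ext e
  refine tendsto_nhds_unique (tendsto_apply_mul_of_restrict hσ e)
    ((tendsto_apply_mul_of_restrict hτ e).congr fun u => ?_)
  obtain ⟨m, hm⟩ := hι u e
  rw [← hm, hσ, hτ]

/-- The functional is `e ↦ ω(u* e u)`, meaningful because `e u` lies in the ideal. As `u` runs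
through an approximate unit, these approximate the extension of `ω`. -/
theorem exists_compressed_functional (hinj : Function.Injective ι)
    (hι : ∀ (l : L) (e : E), e * ι l ∈ Set.range ι) (ω : State L) (u : L) (hu : ‖u‖ ≤ 1) :
    ∃ φ : StrongDual ℂ E, ‖φ‖ ≤ 1 ∧ (∀ e, 0 ≤ φ (star e * e)) ∧
      ∀ l, φ (ι l) = ω.1 (star u * (l * u)) := by
  choose k hk using hι u
  have hk' : ∀ e, ι (star u * k e) = star (ι u) * (e * ι u) := fun e => by
    rw [map_mul, hk, map_star]
  have hnorm : ∀ e, ‖k e‖ ≤ ‖e‖ := fun e => by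
    rw [← NonUnitalStarAlgHom.norm_map ι hinj, hk]
    refine (norm_mul_le _ _).trans (mul_le_of_le_one_right (norm_nonneg _) ?_)
    exact (NonUnitalStarAlgHom.norm_apply_le ι u).trans hu
  let φ₀ : E →ₗ[ℂ] ℂ :=
    { toFun := fun e => ω.1 (star u * k e)
      map_add' := fun a b => by
        rw [← map_add, ← mul_add]
        congr 2
        apply hinj
        rw [map_add, hk, hk, hk, add_mul]
      map_smul' := fun c a => by
        rw [RingHom.id_apply, ← map_smul, ← mul_smul_comm]
        congr 2
        apply hinj
        rw [map_smul, hk, hk, smul_mul_assoc] }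
  let φ : StrongDual ℂ E := φ₀.mkContinuous 1 fun e => by
    refine (ω.1.le_opNorm _).trans ?_
    rw [ω.2.2]
    gcongr
    refine (norm_mul_le _ _).trans ?_
    rw [norm_star]
    exact (mul_le_of_le_one_left (norm_nonneg _) hu).trans (hnorm e)
  refine ⟨φ, φ₀.mkContinuous_norm_le zero_le_one _, fun e => ?_, fun l => ?_⟩
  · have : star u * k (star e * e) = star (k e) * k e := by
      apply hinj
      rw [hk', map_mul, map_star, hk, star_mul]
      simp only [mul_assoc]
    change 0 ≤ ω.1 (star u * k (star e * e))
    rw [this]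
    exact ω.2.1 _
  · change ω.1 (star u * k (ι l)) = _
    congr 2
    apply hinj
    rw [hk, map_mul]

/-- A state of a two-sided ideal extends to a state of the algebra. -/
theorem exists_extension (hinj : Function.Injective ι)
    (hι : ∀ (l : L) (e : E), e * ι l ∈ Set.range ι) (ω : State L) :
    ∃ σ : State E, ∀ l : L, σ.1 (ι l) = ω.1 l := by
  let : PartialOrder L := CStarAlgebra.spectralOrder L
  have : StarOrderedRing L := CStarAlgebra.spectralOrderedRing L
  have hl := CStarAlgebra.increasingApproximateUnit L
  choose! s hs1 hspos hsl using exists_compressed_functional hinj hι ω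
  -- By Banach–Alaoglu the compressed functionals converge weak-* along an ultrafilter finer than
  -- the approximate unit; the limit is the extension.
  let U : Ultrafilter L := Ultrafilter.of (CStarAlgebra.approximateUnit L)
  have hU : ∀ᶠ u in (U : Filter L), ‖u‖ ≤ 1 := Ultrafilter.of_le _ hl.eventually_norm
  obtain ⟨σ, hσ1, hσ⟩ := (WeakDual.isCompact_closedBall (0 : StrongDual ℂ E) 1).ultrafilter_le_nhds
    (U.map fun u => StrongDual.toWeakDual (s u)) (by
      rw [Ultrafilter.coe_map, le_principal_iff, Filter.mem_map]
      filter_upwards [hU] with u hu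
      simpa using hs1 u hu)
  have hlim : ∀ e, Tendsto (fun u => s u e) U (𝓝 (WeakDual.toStrongDual σ e)) := fun e =>
    ((WeakDual.eval_continuous e).tendsto σ).comp hσ
  have hext : ∀ l, WeakDual.toStrongDual σ (ι l) = ω.1 l := fun l => by
    refine tendsto_nhds_unique (hlim (ι l)) ?_
    have h1 : Tendsto (fun u => ‖l * u - l‖ + ‖u * l - l‖) (CStarAlgebra.approximateUnit L)
        (𝓝 0) := by
      simpa using (tendsto_iff_norm_sub_tendsto_zero.1 (hl.tendsto_mul_left l)).add
        (tendsto_iff_norm_sub_tendsto_zero.1 (hl.tendsto_mul_right l))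
    have h2 : Tendsto (fun u => star u * (l * u)) (CStarAlgebra.approximateUnit L) (𝓝 l) := by
      rw [tendsto_iff_norm_sub_tendsto_zero]
      refine squeeze_zero' (Eventually.of_forall fun u => norm_nonneg _) ?_ h1
      filter_upwards [hl.eventually_norm, hl.eventually_star_eq] with u hu hus
      have : star u * (l * u) - l = u * (l * u - l) + (u * l - l) := by
        rw [hus]
        noncomm_ring
      rw [this]
      refine (norm_add_le _ _).trans ?_
      gcongr
      exact (norm_mul_le _ _).trans (mul_le_of_le_one_left (norm_nonneg _) hu)
    refine (((ω.1.continuous.tendsto l).comp h2).mono_left (Ultrafilter.of_le _)).congr' ?_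
    filter_upwards [hU] with u hu
    exact (hsl u hu l).symm
  refine ⟨⟨WeakDual.toStrongDual σ, fun e => ?_, le_antisymm (by simpa using hσ1) ?_⟩, hext⟩
  · refine ge_of_tendsto (hlim (star e * e)) ?_
    filter_upwards [hU] with u hu
    exact hspos u hu e
  · rw [← ω.2.2]
    refine ω.1.opNorm_le_bound (norm_nonneg _) fun l => ?_
    rw [← hext, ← NonUnitalStarAlgHom.norm_map ι hinj]
    exact ContinuousLinearMap.le_opNorm _ _

end Ideal

end HostAlgebra

namespace HostAlgebra

/-! ### Pure states by Krein–Milman -/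

section Extreme

variable {A : Type*} [NonUnitalCStarAlgebra A]

instance locallyConvexSpace_weakDual : LocallyConvexSpace ℝ (WeakDual ℂ A) :=
  Topology.IsInducing.locallyConvexSpace (F := A → ℂ)
    (f := ({ toFun := fun φ a => φ a
             map_add' := fun _ _ => rfl
             map_smul' := fun _ _ => rfl } : WeakDual ℂ A →ₗ[ℝ] (A → ℂ))) ⟨rfl⟩

/-- The positive functionals of norm at most one, as a subset of the weak dual. -/
def quasiStates (A : Type*) [NonUnitalCStarAlgebra A] : Set (WeakDual ℂ A) :=
  WeakDual.toStrongDual ⁻¹' Metric.closedBall 0 1 ∩ {φ | ∀ a : A, 0 ≤ φ (star a * a)}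

theorem isCompact_quasiStates : IsCompact (quasiStates A) := by
  refine (WeakDual.isCompact_closedBall (0 : StrongDual ℂ A) 1).inter_right ?_
  rw [Set.ofPred_forall]
  exact isClosed_iInter fun a => isClosed_Ici.preimage (WeakDual.eval_continuous _)

theorem convex_quasiStates : Convex ℝ (quasiStates A) := by
  intro φ hφ ψ hψ s t hs ht hst
  refine ⟨(convex_closedBall (0 : StrongDual ℂ A) 1) hφ.1 hψ.1 hs ht hst, fun a => ?_⟩
  exact add_nonneg (smul_nonneg hs (hφ.2 a)) (smul_nonneg ht (hψ.2 a))

/-- A C⋆-algebra with a state has a pure state. -/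
theorem exists_pure_state (ω₀ : State A) :
    ∃ ω : State A, ∀ (φ ψ : State A) (s t : ℝ), 0 < s → 0 < t → s + t = 1 →
      ω.1 = s • φ.1 + t • ψ.1 → φ = ω := by
  have hmem : ∀ ω : State A, StrongDual.toWeakDual ω.1 ∈ quasiStates A := fun ω =>
    ⟨by simp [ω.2.2], ω.2.1⟩
  -- The compact set includes `0`, which is itself extreme; were it the only extreme point,
  -- Krein–Milman would leave no room for `ω₀`.
  have hne : ∃ φ ∈ (quasiStates A).extremePoints ℝ, φ ≠ 0 := by
    by_contra! h
    have h1 : closure (convexHull ℝ ((quasiStates A).extremePoints ℝ)) ⊆ {0} :=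
      closure_minimal (convexHull_min h (convex_singleton 0)) isClosed_singleton
    have hK : closure (convexHull ℝ ((quasiStates A).extremePoints ℝ)) = quasiStates A :=
      closure_convexHull_extremePoints isCompact_quasiStates convex_quasiStates
    have h2 : ω₀.1 = 0 := h1 (hK.symm.subset (hmem ω₀))
    simpa [h2] using ω₀.2.2
  obtain ⟨φ, hφ, hφ0⟩ := hne
  have hφ1 : ‖WeakDual.toStrongDual φ‖ = 1 := by
    have hle : ‖WeakDual.toStrongDual φ‖ ≤ 1 := by simpa using hφ.1.1
    have hpos : 0 < ‖WeakDual.toStrongDual φ‖ := by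
      rw [norm_pos_iff]
      simpa using hφ0
    -- If `r = ‖φ‖ < 1`, then `φ = r (φ / r) + (1 - r) 0` contradicts extremality.
    by_contra hlt
    set r := ‖WeakDual.toStrongDual φ‖
    have hr : r < 1 := lt_of_le_of_ne hle hlt
    have hmem1 : r⁻¹ • φ ∈ quasiStates A := by
      refine ⟨?_, fun a => smul_nonneg (inv_nonneg.2 hpos.le) (hφ.1.2 a)⟩
      have : ‖r⁻¹ • WeakDual.toStrongDual φ‖ = 1 := by
        rw [norm_smul, norm_inv, Real.norm_of_nonneg hpos.le, inv_mul_cancel₀ hpos.ne']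
      exact mem_closedBall_zero_iff.2 this.le
    have hmem0 : (0 : WeakDual ℂ A) ∈ quasiStates A := ⟨by simp, fun a => le_rfl⟩
    have h := ((mem_extremePoints ..).1 hφ).2 _ hmem1 _ hmem0
      ⟨r, 1 - r, hpos, sub_pos.2 hr, by ring, by
        rw [smul_zero, add_zero]
        exact smul_inv_smul₀ hpos.ne' φ⟩
    exact hφ0 h.2.symm
  refine ⟨⟨WeakDual.toStrongDual φ, hφ.1.2, hφ1⟩, fun ψ χ s t hs ht hst h => ?_⟩
  have h := ((mem_extremePoints ..).1 hφ).2 _ (hmem ψ) _ (hmem χ) ⟨s, t, hs, ht, hst, h.symm⟩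
  exact Subtype.ext h.1

end Extreme

end HostAlgebra

namespace HostAlgebra

/-! ### Vector functionals of representations -/

section VectorFunctional

variable {F : Type u} [CStarAlgebra F] {H : Type v} [NormedAddCommGroup H]
  [InnerProductSpace ℂ H] [CompleteSpace H]

/-- The functional `f ↦ ⟨v, π(f) v⟩`. -/
noncomputable def vectorFunctional (π : F →⋆ₐ[ℂ] (H →L[ℂ] H)) (v : H) : StrongDual ℂ F :=
  (innerSL ℂ v).comp ((ContinuousLinearMap.apply ℂ H v).comp
    (π.toAlgHom.toLinearMap.mkContinuous 1 fun b => by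
      simpa using NonUnitalStarAlgHom.norm_apply_le π b))

theorem vectorFunctional_apply (π : F →⋆ₐ[ℂ] (H →L[ℂ] H)) (v : H) (f : F) :
    vectorFunctional π v f = ⟪v, π f v⟫_ℂ := rfl

theorem continuous_vectorFunctional (π : F →⋆ₐ[ℂ] (H →L[ℂ] H)) :
    Continuous (vectorFunctional π) := by
  unfold vectorFunctional
  fun_prop

theorem vectorFunctional_nonneg (π : F →⋆ₐ[ℂ] (H →L[ℂ] H)) (v : H) (f : F) :
    0 ≤ vectorFunctional π v (star f * f) := by
  rw [vectorFunctional_apply, map_mul, map_star, ContinuousLinearMap.star_eq_adjoint,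
    mul_apply_eq_comp, ContinuousLinearMap.adjoint_inner_right, inner_self_eq_norm_sq_to_K]
  positivity

omit [CompleteSpace H] in
theorem inner_self_eq_coe_norm_sq (v : H) : ⟪v, v⟫_ℂ = ((‖v‖ ^ 2 : ℝ) : ℂ) := by
  rw [inner_self_eq_norm_sq_to_K]
  norm_cast

/-- The vector state `f ↦ ⟨v, π(f) v⟩ / ‖v‖²`. -/
noncomputable def vectorState (π : F →⋆ₐ[ℂ] (H →L[ℂ] H)) (v : H) (hv : v ≠ 0) : State F :=
  have hpos : ∀ f : F, 0 ≤ ((‖v‖ ^ 2)⁻¹ • vectorFunctional π v) (star f * f) := fun f => by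
    rw [smul_apply]
    exact smul_nonneg (by positivity : (0 : ℝ) ≤ (‖v‖ ^ 2)⁻¹) (vectorFunctional_nonneg π v f)
  ⟨(‖v‖ ^ 2)⁻¹ • vectorFunctional π v, hpos, (norm_eq_one_iff_apply_one hpos).2 (by
    have : ‖v‖ ≠ 0 := norm_ne_zero_iff.2 hv
    rw [smul_apply, vectorFunctional_apply, map_one, one_apply_eq_self,
      inner_self_eq_coe_norm_sq, Complex.real_smul, ← Complex.ofReal_mul,
      inv_mul_cancel₀ (pow_ne_zero 2 this), Complex.ofReal_one])⟩

omit [CompleteSpace H] in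
/-- Operators in the commutant which agree on a cyclic vector are equal. -/
theorem eq_of_apply_cyclic {R : Type*} {ρ : R → H →L[ℂ] H} {Ω : H}
    (hΩ : DenseRange fun f => ρ f Ω) {S T : H →L[ℂ] H}
    (hS : ∀ f, S * ρ f = ρ f * S) (hT : ∀ f, T * ρ f = ρ f * T) (h : S Ω = T Ω) : S = T := by
  apply DFunLike.coe_injective
  refine hΩ.equalizer S.continuous T.continuous (funext fun f => ?_)
  have h1 := congr($(hS f) Ω)
  have h2 := congr($(hT f) Ω)
  simp only [mul_apply_eq_comp] at h1 h2
  simp only [Function.comp_apply]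
  rw [h1, h2, h]

theorem norm_sq_smul_vectorState (π : F →⋆ₐ[ℂ] (H →L[ℂ] H)) (v : H) (hv : v ≠ 0) :
    ‖v‖ ^ 2 • (vectorState π v hv).1 = vectorFunctional π v :=
  smul_inv_smul₀ (pow_ne_zero 2 (norm_ne_zero_iff.2 hv)) _

end VectorFunctional

/-! ### Vector states in a folium -/

section GNS

variable {F : Type u} [CStarAlgebra F] [PartialOrder F] [StarOrderedRing F]

theorem State.π_apply_Ω (ω : State F) (f : F) :
    ω.π f ω.Ω = ((ω.toPLM.toPreGNS f : ω.toPLM.PreGNS) : ω.H) := by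
  change ω.toPLM.gnsNonUnitalStarAlgHom f (ω.toPLM.toPreGNS 1 : ω.toPLM.PreGNS) = _
  rw [PositiveLinearMap.gnsNonUnitalStarAlgHom_apply_coe]
  simp

theorem State.inner_π_Ω (ω : State F) (f g : F) :
    ⟪ω.π f ω.Ω, ω.π g ω.Ω⟫_ℂ = ω.1 (star f * g) := by
  rw [State.π_apply_Ω, State.π_apply_Ω, UniformSpace.Completion.inner_coe]
  rfl

theorem State.inner_Ω_π_Ω (ω : State F) (f : F) : ⟪ω.Ω, ω.π f ω.Ω⟫_ℂ = ω.1 f := by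
  simpa using ω.inner_π_Ω 1 f

theorem State.vectorFunctional_Ω (ω : State F) : vectorFunctional ω.π ω.Ω = ω.1 := by
  ext f
  exact ω.inner_Ω_π_Ω f

theorem State.denseRange_π_Ω (ω : State F) : DenseRange fun f => ω.π f ω.Ω := by
  simp_rw [State.π_apply_Ω]
  exact UniformSpace.Completion.denseRange_coe (α := ω.toPLM.PreGNS)

theorem State.norm_Ω (ω : State F) : ‖ω.Ω‖ = 1 := by
  have h := ω.inner_Ω_π_Ω 1
  rw [map_one, one_apply_eq_self, ω.apply_one, inner_self_eq_coe_norm_sq] at h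
  have h' : ‖ω.Ω‖ ^ 2 = 1 := by exact_mod_cast h
  exact (pow_eq_one_iff_of_nonneg (norm_nonneg _) two_ne_zero).1 h'

theorem State.Ω_ne_zero (ω : State F) : ω.Ω ≠ 0 := by
  rw [← norm_ne_zero_iff, ω.norm_Ω]
  exact one_ne_zero

/-- A folium contains all vector states of the GNS representations of its members. -/
theorem IsFolium.vectorState_mem {S₀ : Set (State F)} (hS₀ : IsFolium S₀) {ω : State F}
    (hω : ω ∈ S₀) (v : ω.H) (hv : v ≠ 0) : vectorState ω.π v hv ∈ S₀ := by
  have hmem : (vectorState ω.π v hv).1 ∈ closure (Subtype.val '' S₀) := by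
    -- Approximation by nonzero vectors `π(b) Ω` keeps the normalization continuous; norm-closedness
    -- of the folium then reduces the claim to such vectors.
    have hv' : v ∈ closure (Set.range (fun f => ω.π f ω.Ω) ∩ {0}ᶜ) := by
      have := (isOpen_compl_singleton (x := (0 : ω.H))).inter_closure
        (t := Set.range fun f => ω.π f ω.Ω) ⟨hv, ω.denseRange_π_Ω v⟩
      rwa [Set.inter_comm]
    have hc : ContinuousWithinAt (fun w : ω.H => (‖w‖ ^ 2)⁻¹ • vectorFunctional ω.π w)
        (Set.range (fun f => ω.π f ω.Ω) ∩ {0}ᶜ) v := by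
      have h1 : ContinuousAt (fun w : ω.H => (‖w‖ ^ 2)⁻¹) v :=
        (continuous_norm.pow 2).continuousAt.inv₀ (pow_ne_zero 2 (norm_ne_zero_iff.2 hv))
      exact (h1.smul (continuous_vectorFunctional ω.π).continuousAt).continuousWithinAt
    change (‖v‖ ^ 2)⁻¹ • vectorFunctional ω.π v ∈
      closure (Subtype.val '' S₀ : Set (StrongDual ℂ F))
    refine hc.mem_closure hv' ?_
    rintro _ ⟨⟨b, rfl⟩, hb⟩
    have hb0 : ω.π b ω.Ω ≠ 0 := hb
    refine ⟨vectorState ω.π _ hb0, ?_, rfl⟩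
    have hn : ‖ω.π b ω.Ω‖ ≠ 0 := norm_ne_zero_iff.2 hb0
    -- Rescaling `b` by `r` gives `ω((r b)* (r b)) = 1`, as the invariance of the folium requires.
    set r : ℂ := ((‖ω.π b ω.Ω‖⁻¹ : ℝ) : ℂ)
    have hr : star r * r = (((‖ω.π b ω.Ω‖ ^ 2)⁻¹ : ℝ) : ℂ) := by
      rw [Complex.star_def, Complex.conj_ofReal, ← Complex.ofReal_mul, ← sq, inv_pow]
    have key : ∀ f, (vectorState ω.π _ hb0).1 f = ω.1 (star (r • b) * f * (r • b)) := fun f => by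
      change (‖ω.π b ω.Ω‖ ^ 2)⁻¹ • vectorFunctional ω.π (ω.π b ω.Ω) f = _
      rw [vectorFunctional_apply, star_smul, smul_mul_assoc, smul_mul_assoc, mul_smul_comm,
        map_smul, map_smul, smul_smul, hr, mul_assoc, ← ω.inner_π_Ω, map_mul, mul_apply_eq_comp]
      rfl
    refine hS₀.invariant ω hω (r • b) ?_ _ key
    have h1 := key 1
    rw [(vectorState ω.π _ hb0).apply_one, mul_one] at h1
    exact h1.symm
  rw [hS₀.isClosed.closure_eq] at hmem
  obtain ⟨η, hη, h⟩ := hmem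
  rwa [← Subtype.ext h]

end GNS

end HostAlgebra

/-! ### From an ideal host to a one-point spectrum -/

namespace HostAlgebra

/-- A folium with an ideal host contains a state which is extreme in the folium, namely the image
of a pure state of the host. -/
theorem HasIdealHost.exists_extreme {F : Type u} [CStarAlgebra F] {S₀ : Set (State F)}
    (h : HasIdealHost.{u, v, w} F S₀) (hne : S₀.Nonempty) :
    ∃ η ∈ S₀, ∀ η₁ ∈ S₀, ∀ η₂ ∈ S₀, ∀ s t : ℝ, 0 < s → 0 < t → s + t = 1 →
      η.1 = s • η₁.1 + t • η₂.1 → η₁ = η := by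
  obtain ⟨h, hideal⟩ := h
  obtain ⟨η₀, hη₀⟩ := hne
  obtain ⟨ω₀, -⟩ := (h.θ_range η₀).1 hη₀
  obtain ⟨ω, hω⟩ := exists_pure_state ω₀
  obtain ⟨σ, hσ⟩ := exists_extension h.ι_injective (fun l e => (hideal l e).1) ω
  refine ⟨σ.comap h.ξ, (h.θ_range _).2 ⟨ω, σ, hσ, fun f => rfl⟩, ?_⟩
  intro η₁ h₁ η₂ h₂ s t hs ht hst heq
  obtain ⟨ω₁, σ₁, hσ₁, hη₁⟩ := (h.θ_range η₁).1 h₁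
  obtain ⟨ω₂, σ₂, hσ₂, hη₂⟩ := (h.θ_range η₂).1 h₂
  -- The mixture of the extensions `σ₁`, `σ₂` extends the mixture of `ω₁`, `ω₂` and restricts to the
  -- same `η` as `σ`.
  have hmix : ω = ω₁.mix ω₂ s t hs.le ht.le hst := by
    refine h.θ_injective _ _ (σ.comap h.ξ) ⟨σ, hσ, fun f => rfl⟩
      ⟨σ₁.mix σ₂ s t hs.le ht.le hst, fun l => ?_, fun f => ?_⟩
    · change s • σ₁.1 (h.ι l) + t • σ₂.1 (h.ι l) = s • ω₁.1 l + t • ω₂.1 l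
      rw [hσ₁, hσ₂]
    · rw [heq]
      change s • η₁.1 f + t • η₂.1 f = s • σ₁.1 (h.ξ f) + t • σ₂.1 (h.ξ f)
      rw [hη₁, hη₂]
  obtain rfl := hω ω₁ ω₂ s t hs ht hst (congrArg Subtype.val hmix)
  have hσσ : σ₁ = σ := extension_unique (fun l e => (hideal l e).2) hσ₁ hσ
  ext f
  rw [hη₁, hσσ, State.comap_apply]

namespace MaxAbelian

variable {F : Type u} [CStarAlgebra F] {H : Type v} [NormedAddCommGroup H]
  [InnerProductSpace ℂ H] [CompleteSpace H] {π : F →⋆ₐ[ℂ] (H →L[ℂ] H)}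

theorem ofFun_mem (C : MaxAbelian π) (f : C(C.X, ℝ)) : C.ofFun f ∈ C.alg :=
  Subtype.property _

theorem ofFun_commutant (C : MaxAbelian π) (f : C(C.X, ℝ)) (g : F) :
    C.ofFun f * π g = π g * C.ofFun f :=
  C.commutant _ (C.ofFun_mem f) g

theorem ofFun_one (C : MaxAbelian π) : C.ofFun 1 = 1 := by
  unfold ofFun
  have h : (⟨fun x => ((1 : C(C.X, ℝ)) x : ℂ),
      Complex.continuous_ofReal.comp (1 : C(C.X, ℝ)).continuous⟩ : C(C.X, ℂ)) = 1 := by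
    ext x
    simp
  rw [h, map_one]
  rfl

theorem ofFun_injective (C : MaxAbelian π) : Function.Injective C.ofFun := by
  intro f g h
  have h1 := (gelfandStarTransform C.alg).symm.injective (Subtype.ext h)
  ext x
  have h2 := DFunLike.congr_fun h1 x
  exact Complex.ofReal_injective h2

theorem ofFun_zero (C : MaxAbelian π) : C.ofFun 0 = 0 := by
  simpa using C.ofFun_smul 0 0

/-- `C.ofFun f` is self-adjoint and commutes with `π g`, so one factor crosses the inner product.
The functional is thus linear in `f²`, which is why square roots are used below. -/
theorem vectorFunctional_ofFun (C : MaxAbelian π) (f : C(C.X, ℝ)) (v : H) (g : F) :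
    vectorFunctional π (C.ofFun f v) g = ⟪v, π g (C.ofFun (f * f) v)⟫_ℂ := by
  have h1 := congr($(C.ofFun_commutant f g) (C.ofFun f v))
  simp only [mul_apply_eq_comp] at h1
  rw [vectorFunctional_apply, C.ofFun_mul, mul_apply_eq_comp, ← h1]
  nth_rewrite 3 [← C.star_ofFun f]
  rw [ContinuousLinearMap.star_eq_adjoint, ContinuousLinearMap.adjoint_inner_right]

/-- Integrating the constant `1` gives `‖v‖²`, which would be `0` for the zero measure. -/
theorem measure_univ_pos (C : MaxAbelian π) {v : H} (hv : v ≠ 0) :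
    0 < C.measure v Set.univ := by
  let one : CompactlySupportedContinuousMap C.X ℝ := ⟨1, HasCompactSupport.of_compactSpace _⟩
  have h1 : ∫ x, one x ∂(C.measure v) = C.functional v one :=
    RealRMK.integral_rieszMeasure (C.functional v) one
  have h2 : C.functional v one = ‖v‖ ^ 2 := by
    change (⟪v, C.ofFun 1 v⟫_ℂ).re = _
    rw [C.ofFun_one, one_apply_eq_self, inner_self_eq_coe_norm_sq, Complex.ofReal_re]
  rw [pos_iff_ne_zero]
  intro h0
  rw [MeasureTheory.Measure.measure_univ_eq_zero] at h0
  rw [h0, MeasureTheory.integral_zero_measure, h2] at h1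
  exact pow_ne_zero 2 (norm_ne_zero_iff.2 hv) h1.symm

/-- If the functional of a cyclic vector is a sum of vector functionals only in the trivial way, the
commutant contains only trivial commutative algebras. -/
theorem subsingleton_X (C : MaxAbelian π) {Ω : H} (hcyc : DenseRange fun f => π f Ω)
    (hext : ∀ v w : H, v ≠ 0 → w ≠ 0 →
      vectorFunctional π v + vectorFunctional π w = vectorFunctional π Ω →
      ∃ s : ℝ, vectorFunctional π v = s • vectorFunctional π Ω) : Subsingleton C.X := by
  refine ⟨fun x y => ?_⟩
  by_contra hxy
  obtain ⟨f, hfx, hfy, hf⟩ := exists_continuous_zero_one_of_isClosed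
    (isClosed_singleton (x := x)) (isClosed_singleton (x := y))
    (Set.disjoint_singleton.2 hxy)
  replace hfx : f x = 0 := hfx rfl
  replace hfy : f y = 1 := hfy rfl
  let p : C(C.X, ℝ) := ⟨fun z => √(f z), by fun_prop⟩
  let q : C(C.X, ℝ) := ⟨fun z => √(1 - f z), by fun_prop⟩
  have hp : p * p = f := by
    ext z
    exact Real.mul_self_sqrt (hf z).1
  have hq : q * q = 1 - f := by
    ext z
    exact Real.mul_self_sqrt (sub_nonneg.2 (hf z).2)
  -- A cyclic vector is separating for the commutant, so functions can be compared on `Ω`.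
  have heq : ∀ g k : C(C.X, ℝ), C.ofFun g Ω = C.ofFun k Ω → g = k := fun g k h =>
    C.ofFun_injective (eq_of_apply_cyclic hcyc (C.ofFun_commutant g) (C.ofFun_commutant k) h)
  have hne : ∀ g : C(C.X, ℝ), g ≠ 0 → C.ofFun g Ω ≠ 0 := fun g hg h0 =>
    hg (heq g 0 (by rw [h0, C.ofFun_zero, zero_apply]))
  have hp0 : C.ofFun p Ω ≠ 0 := hne p fun h => by
    have h1 : √(f y) = 0 := DFunLike.congr_fun h y
    rw [hfy, Real.sqrt_one] at h1
    exact one_ne_zero h1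
  have hq0 : C.ofFun q Ω ≠ 0 := hne q fun h => by
    have h1 : √(1 - f x) = 0 := DFunLike.congr_fun h x
    rw [hfx, sub_zero, Real.sqrt_one] at h1
    exact one_ne_zero h1
  have hsum : vectorFunctional π (C.ofFun p Ω) + vectorFunctional π (C.ofFun q Ω) =
      vectorFunctional π Ω := by
    ext g
    rw [add_apply, C.vectorFunctional_ofFun, C.vectorFunctional_ofFun, hp, hq, ← inner_add_right,
      ← map_add, ← add_apply, ← C.ofFun_add, add_sub_cancel, C.ofFun_one,
      one_apply_eq_self, vectorFunctional_apply]
  obtain ⟨s, hs⟩ := hext _ _ hp0 hq0 hsum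
  -- Proportionality says that `f Ω` and `s Ω` have equal inner products with the dense vectors
  -- `π(g) Ω`; hence `f` is the constant `s`.
  have hT : C.ofFun f Ω = C.ofFun (s • 1) Ω := by
    refine hcyc.eq_of_inner_right (𝕜 := ℂ) fun g => ?_
    have hadj : ∀ z : H, ⟪π g Ω, z⟫_ℂ = ⟪Ω, π (star g) z⟫_ℂ := fun z => by
      rw [map_star, ContinuousLinearMap.star_eq_adjoint,
        ContinuousLinearMap.adjoint_inner_right]
    have h := DFunLike.congr_fun hs (star g)
    rw [C.vectorFunctional_ofFun, hp, smul_apply] at h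
    rw [hadj, hadj, h, C.ofFun_smul, C.ofFun_one, smul_apply, one_apply_eq_self, map_smul,
      inner_smul_right, vectorFunctional_apply, Complex.real_smul]
  have hfs := heq _ _ hT
  have hx := DFunLike.congr_fun hfs x
  have hy := DFunLike.congr_fun hfs y
  rw [hfx] at hx
  rw [hfy] at hy
  exact zero_ne_one (hx.trans hy.symm)

end MaxAbelian

section Extreme

variable {F : Type u} [CStarAlgebra F] [PartialOrder F] [StarOrderedRing F]

/-- If a state is extreme in a folium, the commutant of its GNS representation contains only
trivial commutative algebras. -/
theorem IsFolium.subsingleton_X {S₀ : Set (State F)} (hS₀ : IsFolium S₀) {η : State F}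
    (hη : η ∈ S₀) (hext : ∀ η₁ ∈ S₀, ∀ η₂ ∈ S₀, ∀ s t : ℝ, 0 < s → 0 < t → s + t = 1 →
      η.1 = s • η₁.1 + t • η₂.1 → η₁ = η) (C : MaxAbelian η.π) : Subsingleton C.X := by
  -- The weights are the squared norms of the two vectors; they sum to `1` by evaluation at the
  -- unit.
  refine C.subsingleton_X η.denseRange_π_Ω fun v w hv hw h => ⟨‖v‖ ^ 2, ?_⟩
  have hst : ‖v‖ ^ 2 + ‖w‖ ^ 2 = 1 := by
    have h1 := DFunLike.congr_fun h 1
    rw [η.vectorFunctional_Ω, add_apply, vectorFunctional_apply, vectorFunctional_apply, map_one,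
      one_apply_eq_self, one_apply_eq_self, inner_self_eq_coe_norm_sq,
      inner_self_eq_coe_norm_sq, η.apply_one] at h1
    exact_mod_cast h1
  have heq := hext _ (hS₀.vectorState_mem hη v hv) _ (hS₀.vectorState_mem hη w hw)
    (‖v‖ ^ 2) (‖w‖ ^ 2) (pow_pos (norm_pos_iff.2 hv) 2) (pow_pos (norm_pos_iff.2 hw) 2) hst
    (by rw [norm_sq_smul_vectorState, norm_sq_smul_vectorState, h, η.vectorFunctional_Ω])
  rw [η.vectorFunctional_Ω, ← norm_sq_smul_vectorState η.π v hv, heq]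

end Extreme

end HostAlgebra

theorem theorem2p13 {F : Type u} [CStarAlgebra F] [PartialOrder F] [StarOrderedRing F]
    (S₀ : Set (HostAlgebra.State F)) (hS₀ : HostAlgebra.IsFolium S₀) (hne : S₀.Nonempty)
    (C : HostAlgebra.Choice S₀) :
    (HostAlgebra.HasIdealHost.{u, v, w} F S₀ →
      ∃ x : HostAlgebra.TotalSpace C, 0 < HostAlgebra.totalMeasure C {x}) ∧
    ((∀ x : HostAlgebra.TotalSpace C, HostAlgebra.totalMeasure C {x} = 0) →
      ¬ HostAlgebra.HasIdealHost.{u, v, w} F S₀) := by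
  have main : HostAlgebra.HasIdealHost.{u, v, w} F S₀ →
      ∃ x : HostAlgebra.TotalSpace C, 0 < HostAlgebra.totalMeasure C {x} := by
    intro h
    obtain ⟨η, hη, hext⟩ := h.exists_extreme hne
    have hpos := (C ⟨η, hη⟩).measure_univ_pos η.Ω_ne_zero
    have hsub := hS₀.subsingleton_X hη hext (C ⟨η, hη⟩)
    obtain ⟨x, -⟩ := MeasureTheory.nonempty_of_measure_ne_zero hpos.ne'
    refine ⟨⟨⟨η, hη⟩, x⟩, hpos.trans_le ?_⟩
    have hmk : Measurable (Sigma.mk (β := fun ω : S₀ => (C ω).X) ⟨η, hη⟩) :=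
      Measurable.of_le_map (iInf_le _ _)
    -- Only lower bounds are needed, so measurability of the singleton plays no role: the preimage
    -- of the point contains all of `X_η`.
    refine le_trans ?_ (MeasureTheory.Measure.le_iff'.1 (MeasureTheory.Measure.le_sum _ ⟨η, hη⟩) _)
    refine le_trans (MeasureTheory.measure_mono fun z _ => ?_)
      (MeasureTheory.Measure.le_map_apply hmk.aemeasurable _)
    exact congrArg (Sigma.mk _) (hsub.elim z x)
  exact ⟨main, fun h0 h => by
    obtain ⟨x, hx⟩ := main h
    exact hx.ne' (h0 x)⟩
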